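/- For $A\subseteq\mathbb{R}$ let $\tau_A$ be the topology on $\mathbb{R}$ in which the intervals $(x-\varepsilon,x+\varepsilon)$, $\varepsilon>0$, form a neighbourhood base at each $x\in A$, and the intervals $[x,x+\varepsilon)$, $\varepsilon>0$, form a neighbourhood base at each $x\in\mathbb{R}\setminus A$. A topological space $X$ is called quasi-metrizable if there is a function $d\colon X\times X\to[0,\infty)$ with $d(x,y)=0$ if and only if $x=y$, and $d(x,z)\le d(x,y)+d(y,z)$ for all $x,y,z\in X$ (symmetry is not required), such that the open subsets of $X$ are exactly the sets $U$ such that for every $x\in U$ there is $\varepsilon>0$ with $\{y\in X: d(x,y)<\varepsilon\}\subseteq U$. There exists a subset $A$ of $\mathbb{R}$, namely $A=\mathbb{Q}$, such that $(\mathbb{R},\tau_A)$ is not quasi-metrizable. -/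

import Mathlib

open Set Topology

namespace HSpace

/-- The topology `τ_A` on the real line: a set is open when it contains, with each of its points `x`,
some interval `(x - ε, x + ε)` if `x ∈ A`, and some interval `[x, x + ε)` if `x ∉ A`. -/
@[reducible]
def tau (A : Set ℝ) : TopologicalSpace ℝ where
  IsOpen U := ∀ x ∈ U,
    (x ∈ A → ∃ ε > 0, Ioo (x - ε) (x + ε) ⊆ U) ∧ (x ∉ A → ∃ ε > 0, Ico x (x + ε) ⊆ U)
  isOpen_univ := fun _ _ => ⟨fun _ => ⟨1, one_pos, subset_univ _⟩,
    fun _ => ⟨1, one_pos, subset_univ _⟩⟩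
  isOpen_inter := by
    rintro U V hU hV x ⟨hxU, hxV⟩
    refine ⟨fun hx => ?_, fun hx => ?_⟩
    · obtain ⟨a, ha, hUa⟩ := (hU x hxU).1 hx
      obtain ⟨b, hb, hVb⟩ := (hV x hxV).1 hx
      refine ⟨min a b, lt_min ha hb, subset_inter (Subset.trans ?_ hUa) (Subset.trans ?_ hVb)⟩
      · exact Ioo_subset_Ioo (by linarith [min_le_left a b]) (by linarith [min_le_left a b])
      · exact Ioo_subset_Ioo (by linarith [min_le_right a b]) (by linarith [min_le_right a b])
    · obtain ⟨a, ha, hUa⟩ := (hU x hxU).2 hx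
      obtain ⟨b, hb, hVb⟩ := (hV x hxV).2 hx
      refine ⟨min a b, lt_min ha hb, subset_inter (Subset.trans ?_ hUa) (Subset.trans ?_ hVb)⟩
      · exact Ico_subset_Ico_right (by linarith [min_le_left a b])
      · exact Ico_subset_Ico_right (by linarith [min_le_right a b])
  isOpen_sUnion := by
    rintro S hS x ⟨U, hUS, hxU⟩
    refine ⟨fun hx => ?_, fun hx => ?_⟩
    · obtain ⟨a, ha, h⟩ := (hS U hUS x hxU).1 hx
      exact ⟨a, ha, h.trans (subset_sUnion_of_mem hUS)⟩
    · obtain ⟨a, ha, h⟩ := (hS U hUS x hxU).2 hx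
      exact ⟨a, ha, h.trans (subset_sUnion_of_mem hUS)⟩

theorem isOpen_tau_iff (A U : Set ℝ) : IsOpen[tau A] U ↔ ∀ x ∈ U,
    (x ∈ A → ∃ ε > 0, Ioo (x - ε) (x + ε) ⊆ U) ∧ (x ∉ A → ∃ ε > 0, Ico x (x + ε) ⊆ U) :=
  Iff.rfl

theorem isOpen_tau_Ioo (A : Set ℝ) (a b : ℝ) : IsOpen[tau A] (Ioo a b) := by
  rintro x ⟨hax, hxb⟩
  refine ⟨fun _ => ⟨min (x - a) (b - x), lt_min (by linarith) (by linarith), ?_⟩,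
    fun _ => ⟨b - x, by linarith, ?_⟩⟩
  · exact Ioo_subset_Ioo (by linarith [min_le_left (x - a) (b - x)])
      (by linarith [min_le_right (x - a) (b - x)])
  · rintro y ⟨h1, h2⟩
    exact ⟨by linarith, by linarith⟩

theorem isOpen_tau_Ico (A : Set ℝ) {a : ℝ} (ha : a ∉ A) (b : ℝ) : IsOpen[tau A] (Ico a b) := by
  rintro x ⟨hax, hxb⟩
  refine ⟨fun hx => ?_, fun _ => ⟨b - x, by linarith, ?_⟩⟩
  · have hne : a ≠ x := fun h => ha (h ▸ hx)
    obtain ⟨ε, hε, h⟩ := (isOpen_tau_Ioo A a b x ⟨lt_of_le_of_ne hax hne, hxb⟩).1 hx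
    exact ⟨ε, hε, h.trans Ioo_subset_Ico_self⟩
  · rintro y ⟨h1, h2⟩
    exact ⟨by linarith, by linarith⟩

/-- At a point of `A`, the intervals `(x - ε, x + ε)` form a neighbourhood base. -/
theorem nhds_tau_of_mem (A : Set ℝ) {x : ℝ} (hx : x ∈ A) :
    (@nhds ℝ (tau A) x).HasBasis (fun ε : ℝ => 0 < ε) fun ε => Ioo (x - ε) (x + ε) := by
  refine ⟨fun s => ?_⟩
  rw [@mem_nhds_iff ℝ (tau A) x s]
  constructor
  · rintro ⟨U, hUs, hU, hxU⟩
    obtain ⟨ε, hε, h⟩ := (hU x hxU).1 hx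
    exact ⟨ε, hε, h.trans hUs⟩
  · rintro ⟨ε, hε, h⟩
    exact ⟨_, h, isOpen_tau_Ioo A _ _, by linarith, by linarith⟩

/-- At a point outside `A`, the intervals `[x, x + ε)` form a neighbourhood base. -/
theorem nhds_tau_of_notMem (A : Set ℝ) {x : ℝ} (hx : x ∉ A) :
    (@nhds ℝ (tau A) x).HasBasis (fun ε : ℝ => 0 < ε) fun ε => Ico x (x + ε) := by
  refine ⟨fun s => ?_⟩
  rw [@mem_nhds_iff ℝ (tau A) x s]
  constructor
  · rintro ⟨U, hUs, hU, hxU⟩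
    obtain ⟨ε, hε, h⟩ := (hU x hxU).2 hx
    exact ⟨ε, hε, h.trans hUs⟩
  · rintro ⟨ε, hε, h⟩
    exact ⟨_, h, isOpen_tau_Ico A hx _, le_rfl, by linarith⟩

/-- `d` is a quasi-metric on `X`: a metric, except that it need not be symmetric. -/
structure IsQuasiMetric {X : Type*} (d : X → X → ℝ) : Prop where
  nonneg : ∀ x y, 0 ≤ d x y
  eq_zero_iff : ∀ x y, d x y = 0 ↔ x = y
  triangle : ∀ x y z, d x z ≤ d x y + d y z

/-- A topology is quasi-metrizable when, for some quasi-metric `d`, the open sets are exactly the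
sets that contain, with each of their points `x`, a ball `{y | d x y < ε}` with `ε > 0`. -/
def QuasiMetrizable {X : Type*} (t : TopologicalSpace X) : Prop :=
  ∃ d : X → X → ℝ, IsQuasiMetric d ∧
    ∀ U : Set X, IsOpen[t] U ↔ ∀ x ∈ U, ∃ ε > 0, {y | d x y < ε} ⊆ U

end HSpace

namespace HSpace

/-! A quasi-metric `d` gives each `x ∉ A` a radius `r` whose ball at `x` has no point left of `x`,
and a length `δ` with `[x, x + δ)` inside the `r / 2`-ball. By Baire (`exists_Ioo_subset_closure`),
one pair `(r, δ)` serves a set dense in some interval. That interval contains some `q ∈ A`, whose `r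
/ 2`-ball extends left of `q`. For such an `x` just left of `q`, passing through `q` reaches points
left of `x` at distance below `r`, a contradiction. -/

theorem IsQuasiMetric.isOpen_ball {X : Type*} {t : TopologicalSpace X} {d : X → X → ℝ}
    (hd : IsQuasiMetric d)
    (ht : ∀ U : Set X, IsOpen[t] U ↔ ∀ x ∈ U, ∃ ε > 0, {y | d x y < ε} ⊆ U) (x : X) (r : ℝ) :
    IsOpen[t] {y | d x y < r} := by
  refine (ht _).2 fun y hy => ⟨r - d x y, sub_pos.2 hy, fun z hz => ?_⟩
  have hyz : d y z < r - d x y := hz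
  have := hd.triangle x y z
  show d x z < r
  linarith

theorem isOpen_tau_Ici {A : Set ℝ} {a : ℝ} (ha : a ∉ A) : IsOpen[tau A] (Ici a) := by
  intro x hx
  refine ⟨fun hxA => ?_, fun _ => ⟨1, one_pos, fun y hy => le_trans hx hy.1⟩⟩
  have hne : a ≠ x := fun h => ha (h ▸ hxA)
  have hlt : a < x := lt_of_le_of_ne hx hne
  refine ⟨x - a, sub_pos.2 hlt, fun y hy => ?_⟩
  have := hy.1
  show a ≤ y
  linarith

/-- If the complement of a countable set is covered by countably many sets, then one of these is
dense in some nonempty open interval. -/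
theorem exists_Ioo_subset_closure {ι : Type*} [Countable ι] {A : Set ℝ} (hA : A.Countable)
    (S : ι → Set ℝ) (hS : ∀ x ∉ A, ∃ i, x ∈ S i) :
    ∃ i a b, a < b ∧ Ioo a b ⊆ closure (S i) := by
  have : Countable A := hA.to_subtype
  -- The points of `A` join the cover as singletons, which have empty interior, so Baire's theorem
  -- must select some `closure (S i)`.
  let F : ι ⊕ A → Set ℝ := Sum.elim (fun i => closure (S i)) fun x => {(x : ℝ)}
  have hF : ∀ j, IsClosed (F j) := by
    rintro (i | x)
    · exact isClosed_closure
    · exact isClosed_singleton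
  have hU : ⋃ j, F j = univ := by
    refine eq_univ_of_forall fun x => mem_iUnion.2 ?_
    by_cases hx : x ∈ A
    · exact ⟨Sum.inr ⟨x, hx⟩, rfl⟩
    · obtain ⟨i, hi⟩ := hS x hx
      exact ⟨Sum.inl i, subset_closure hi⟩
  obtain ⟨i | x, y, hy⟩ := nonempty_interior_of_iUnion_of_closed hF hU
  · obtain ⟨a, b, hab, h⟩ := mem_nhds_iff_exists_Ioo_subset.1 (mem_interior_iff_mem_nhds.1 hy)
    exact ⟨i, a, b, hab.1.trans hab.2, h⟩
  · simp [F] at hy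

/-- If `A` is countable and dense, then `τ_A` is not quasi-metrizable. -/
theorem not_quasiMetrizable_tau {A : Set ℝ} (hA : A.Countable) (hdense : Dense A) :
    ¬ QuasiMetrizable (tau A) := by
  rintro ⟨d, hd, ht⟩
  have hself : ∀ x, d x x = 0 := fun x => (hd.eq_zero_iff x x).2 rfl
  let S : ℕ × ℕ → Set ℝ := fun p =>
    {x | (∀ y, d x y < 1 / (p.1 + 1) → x ≤ y) ∧
      ∀ y ∈ Ico x (x + 1 / (p.2 + 1)), d x y < 1 / (p.1 + 1) / 2}
  have hS : ∀ x ∉ A, ∃ p, x ∈ S p := by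
    intro x hx
    obtain ⟨ε, hε, hball⟩ := (ht _).1 (isOpen_tau_Ici hx) x self_mem_Ici
    obtain ⟨n, hn⟩ := exists_nat_one_div_lt hε
    have hr : (0 : ℝ) < 1 / (n + 1) / 2 := by positivity
    obtain ⟨δ, hδ, hIco⟩ :=
      (hd.isOpen_ball ht x (1 / (n + 1) / 2) x ((hself x).trans_lt hr)).2 hx
    obtain ⟨k, hk⟩ := exists_nat_one_div_lt hδ
    exact ⟨(n, k), fun y hy => hball (hy.trans hn),
      fun y hy => hIco ⟨hy.1, hy.2.trans (by gcongr)⟩⟩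
  obtain ⟨⟨n, k⟩, a, b, hab, hcl⟩ := exists_Ioo_subset_closure hA S hS
  obtain ⟨q, hqA, haq, hqb⟩ := hdense.exists_between hab
  have hr : (0 : ℝ) < 1 / (n + 1) / 2 := by positivity
  have hk : (0 : ℝ) < 1 / (k + 1) := by positivity
  obtain ⟨ε, hε, hIoo⟩ :=
    (hd.isOpen_ball ht q (1 / (n + 1) / 2) q ((hself q).trans_lt hr)).1 hqA
  have hlt : max a (max (q - ε) (q - 1 / (k + 1))) < q :=
    max_lt haq (max_lt (by linarith) (by linarith))
  -- Density is applied at `z` rather than at `q`, to get a point of `S (n, k)` strictly left of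
  -- `q`.
  obtain ⟨z, hz, hzq⟩ := exists_between hlt
  obtain ⟨hza, hz'⟩ := max_lt_iff.1 hz
  obtain ⟨x, hx, hxS⟩ := mem_closure_iff.1 (hcl ⟨hza, hzq.trans hqb⟩) _ isOpen_Ioo ⟨hz, hzq⟩
  obtain ⟨-, hx'⟩ := max_lt_iff.1 hx.1
  obtain ⟨hxε, hxk⟩ := max_lt_iff.1 hx'
  obtain ⟨y, hy, hyx⟩ := exists_between hxε
  have hxq : d x q < 1 / (n + 1) / 2 := hxS.2 q ⟨hx.2.le, by dsimp only; linarith⟩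
  have hqy : d q y < 1 / (n + 1) / 2 := hIoo ⟨hy, by linarith [hx.2]⟩
  have hxy : d x y < 1 / (n + 1) := by linarith [hd.triangle x q y]
  exact absurd (hxS.1 y hxy) (not_le.2 hyx)

end HSpace

theorem mainTheorem9 :
    ∃ A : Set ℝ, A = Set.range ((↑) : ℚ → ℝ) ∧ ¬ HSpace.QuasiMetrizable (HSpace.tau A) :=
  ⟨_, rfl, HSpace.not_quasiMetrizable_tau (Set.countable_range _) Rat.denseRange_cast⟩
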